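/- For a C*-algebra $B$, let $\mathrm{gr}_0(B)$ be the smallest integer $n\ge 0$ such that for all self-adjoint $a_0,\dots,a_n\in B$, all $\varepsilon>0$ and all $c\in B$ there exist self-adjoint $b_0,\dots,b_n\in B$ with $\|b_j-a_j\|<\varepsilon$ for $j=0,\dots,n$ and an element $d$ of the sub-C*-algebra $C^*(b_0,\dots,b_n)$ generated by $b_0,\dots,b_n$ with $\|c-d\|<\varepsilon$ (and $\mathrm{gr}_0(B)=\infty$ if there is no such $n$). The generator rank of $B$ is $\mathrm{gr}(B):=\mathrm{gr}_0(\widetilde{B})$, where $\widetilde{B}$ is the minimal unitization of $B$ (so $\widetilde{B}=B$ if $B$ is unital). A unital C*-algebra $B$ has real rank zero if the invertible self-adjoint elements are dense in the set of all self-adjoint elements of $B$. A UHF-algebra is a unital C*-algebra $D$ that is the closure of the union of an increasing sequence of sub-C*-algebras that contain the unit of $D$ and are isomorphic to full matrix algebras $M_{n_k}(\mathbb{C})$, $n_k\geq 1$; it is of infinite type if $D\not\cong\mathbb{C}$ and every prime that occurs in the supernatural number of $D$ occurs with infinite exponent, that is, for every prime $p$ such that $M_p(\mathbb{C})$ embeds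 unitally into $D$, the algebra $M_{p^k}(\mathbb{C})$ embeds unitally into $D$ for every $k$. **Proposition.** Let $A$ be a separable, unital C*-algebra of real rank zero, and suppose that there is a UHF-algebra $D$ of infinite type such that $A\cong A\otimes D$ (since $D$ is nuclear, all C*-tensor products of $A$ and $D$ agree). Then $\mathrm{gr}(A)\leq 1$. -/

import Mathlib

open scoped TensorProduct

universe u v

noncomputable section

namespace CStarGen

/-- `C*(b₀, …, bₙ)`: the closed, not necessarily unital, star-subalgebra generated by the family. -/
def generatedCStar {A : Type u} [NonUnitalCStarAlgebra A] {n : ℕ} (b : Fin n → A) :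
    NonUnitalStarSubalgebra ℂ A :=
  (NonUnitalStarAlgebra.adjoin ℂ (Set.range b)).topologicalClosure

/-- The condition "`gr₀(A) ≤ n`": every self-adjoint `(n+1)`-tuple can be approximated by
self-adjoint tuples whose generated sub-C*-algebra approximately contains a given element. -/
def GeneratorCondition (A : Type u) [NonUnitalCStarAlgebra A] (n : ℕ) : Prop :=
  ∀ a : Fin (n + 1) → A, (∀ j, IsSelfAdjoint (a j)) → ∀ ε : ℝ, 0 < ε → ∀ c : A,
    ∃ b : Fin (n + 1) → A, (∀ j, IsSelfAdjoint (b j)) ∧ (∀ j, ‖b j - a j‖ < ε) ∧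
      ∃ d ∈ generatedCStar b, ‖c - d‖ < ε

/-- The precursor `gr₀(A)`: the smallest `n` satisfying the condition above, `⊤` if there is
none. -/
def generatorRankZero (A : Type u) [NonUnitalCStarAlgebra A] : ℕ∞ :=
  sInf {m : ℕ∞ | ∃ n : ℕ, m = n ∧ GeneratorCondition A n}

open Classical in
/-- The generator rank `gr(A) = gr₀(Ã)`, where the minimal unitization `Ã` is `A` itself if `A` has
a unit, and is obtained from `A` by adjoining a unit otherwise. -/
def generatorRank (A : Type u) [NonUnitalCStarAlgebra A] : ℕ∞ :=
  if ∃ e : A, ∀ a : A, e * a = a ∧ a * e = a then generatorRankZero A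
  else generatorRankZero (Unitization ℂ A)

/-- The real rank of a unital C*-algebra: the smallest `n` such that every self-adjoint
`(n+1)`-tuple is a limit of self-adjoint tuples whose sum of squares is invertible. -/
def realRank (A : Type u) [CStarAlgebra A] : ℕ∞ :=
  sInf {m : ℕ∞ | ∃ n : ℕ, m = n ∧
    ∀ a : Fin (n + 1) → A, (∀ j, IsSelfAdjoint (a j)) → ∀ ε : ℝ, 0 < ε →
      ∃ b : Fin (n + 1) → A, (∀ j, IsSelfAdjoint (b j)) ∧ (∀ j, ‖b j - a j‖ < ε) ∧
        IsUnit (∑ j, b j ^ 2)}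

/-- A UHF-algebra: a unital C*-algebra with an increasing sequence of sub-C*-algebras, all
containing its unit and each isomorphic to a full matrix algebra, whose union is dense. -/
def IsUHF (D : Type v) [CStarAlgebra D] : Prop :=
  ∃ (n : ℕ → ℕ) (B : ℕ → StarSubalgebra ℂ D), Monotone B ∧
    (∀ k, 0 < n k ∧ Nonempty (Matrix (Fin (n k)) (Fin (n k)) ℂ ≃⋆ₐ[ℂ] B k)) ∧
    Dense (⋃ k, (B k : Set D))

/-- The exponent of `p` in the supernatural number of `D`: the supremum of all `k` such that the
algebra of `p ^ k` by `p ^ k` matrices embeds unitally into `D`. -/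
def supernaturalExponent (D : Type v) [CStarAlgebra D] (p : ℕ) : ℕ∞ :=
  ⨆ (k : ℕ) (_ : ∃ f : Matrix (Fin (p ^ k)) (Fin (p ^ k)) ℂ →⋆ₐ[ℂ] D, Function.Injective f),
    (k : ℕ∞)

/-- A UHF-algebra of infinite type: each prime occurs in its supernatural number with exponent
`0` or `∞`, and at least one prime occurs (so that `ℂ` is excluded). -/
def IsUHFOfInfiniteType (D : Type v) [CStarAlgebra D] : Prop :=
  IsUHF D ∧
    (∀ p : ℕ, p.Prime → supernaturalExponent D p = 0 ∨ supernaturalExponent D p = ⊤) ∧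
    ∃ p : ℕ, p.Prime ∧ supernaturalExponent D p = ⊤

/-- `E` is a C*-tensor product of `A` and `D`: it is the completion of the algebraic tensor product
for some C*-norm, i.e. it contains an isomorphic copy of the star-algebra `A ⊗[ℂ] D` as a dense
subalgebra. If `D` is nuclear, as every UHF-algebra is, there is exactly one C*-norm, and `E` is
*the* tensor product of `A` and `D`. -/
def IsCStarTensorProduct (A : Type u) (D : Type v) (E : Type u)
    [CStarAlgebra A] [CStarAlgebra D] [CStarAlgebra E] : Prop :=
  ∃ φ : A ⊗[ℂ] D →⋆ₐ[ℂ] E, Function.Injective φ ∧ DenseRange φ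

/-- `A` tensorially absorbs `D` (is `D`-stable): `A ≅ A ⊗ D`. -/
def TensoriallyAbsorbs (A : Type u) (D : Type v) [CStarAlgebra A] [CStarAlgebra D] : Prop :=
  ∃ (E : Type u) (_ : CStarAlgebra E), IsCStarTensorProduct A D E ∧ Nonempty (A ≃⋆ₐ[ℂ] E)

end CStarGen

end

/-! The algebra `D` is infinite-dimensional, so its matrix subalgebras `B k` grow without bound, and
inside a larger one the commutant of `B k` contains matrix units of size at least three. As `A ≅ A ⊗
D`, the elements `a 0`, `a 1`, `c` can be moved slightly so that they commute with such a system `e`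
in `A` (`exists_approx_commute_matrixUnits`). Now `A` is a matrix algebra over the commutant of `e`,
and the three elements are constant diagonal matrices.

The first generator yields the diagonal units. Real rank zero passes to the commutant by a Schur
complement, so `a 0` is close to some `h` of finite spectrum in the commutant. Adding small distinct
multiples of the `e i i` makes the spectra of the diagonal blocks disjoint and nonzero; polynomials
without constant term then produce every `e i i` (`exists_diagonal_perturbation`).

The second generator yields the rest. A small off-diagonal term is added to `a 1`, with the units `e
o i` in row `o` and `c * e k l` at a place off that row and column. Cutting with the `e i i`
isolates these entries, and they generate `c` (`exists_offDiagonal_perturbation`). -/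

namespace CStarGen

/-! ### Matrix units and amplification -/

/-- A system of matrix units in a star-ring, indexed by `ι` and adding up to the unit. -/
structure IsMatrixUnits {ι R : Type*} [Fintype ι] [DecidableEq ι] [Ring R] [StarRing R]
    (e : ι → ι → R) : Prop where
  mul : ∀ i j k l, e i j * e k l = if j = k then e i l else 0
  star_eq : ∀ i j, star (e i j) = e j i
  sum_eq : ∑ i, e i i = 1

theorem IsMatrixUnits.map {ι R S F : Type*} [Fintype ι] [DecidableEq ι] [Ring R] [StarRing R]
    [Ring S] [StarRing S] [FunLike F R S] [RingHomClass F R S] [StarHomClass F R S]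
    {e : ι → ι → R} (he : IsMatrixUnits e) (f : F) : IsMatrixUnits fun i j => f (e i j) where
  mul i j k l := by rw [← map_mul, he.mul]; split_ifs <;> simp
  star_eq i j := by rw [← map_star, he.star_eq]
  sum_eq := by rw [← map_sum, he.sum_eq, map_one]

theorem isMatrixUnits_single {ι : Type*} [Fintype ι] [DecidableEq ι] :
    IsMatrixUnits (fun i j : ι => Matrix.single i j (1 : ℂ)) where
  mul i j k l := by
    split_ifs with h
    · subst h; simp
    · simp [h]
  star_eq i j := by simp [Matrix.star_eq_conjTranspose]
  sum_eq := Matrix.sum_single_one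

/-- For matrix units `e`, the amplification `∑ i, e i o * y * e o i` of the corner of `y` at `o`. -/
def amplify {ι R : Type*} [Fintype ι] [Ring R] (e : ι → ι → R) (o : ι) (y : R) : R :=
  ∑ i, e i o * y * e o i

namespace IsMatrixUnits

variable {ι R : Type*} [Fintype ι] [DecidableEq ι] [Ring R] [StarRing R] {e : ι → ι → R}

theorem mul_self (he : IsMatrixUnits e) (i j k : ι) : e i j * e j k = e i k := by
  rw [he.mul, if_pos rfl]

theorem mul_of_ne (he : IsMatrixUnits e) {j k : ι} (h : j ≠ k) (i l : ι) : e i j * e k l = 0 := by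
  rw [he.mul, if_neg h]

theorem mul_amplify (he : IsMatrixUnits e) (o a b : ι) (y : R) :
    e a b * amplify e o y = e a o * y * e o b := by
  rw [amplify, Finset.mul_sum, Finset.sum_eq_single b]
  · rw [← mul_assoc, ← mul_assoc, he.mul_self]
  · intro i _ hi
    rw [← mul_assoc, ← mul_assoc, he.mul_of_ne hi.symm, zero_mul, zero_mul]
  · simp

theorem amplify_mul (he : IsMatrixUnits e) (o a b : ι) (y : R) :
    amplify e o y * e a b = e a o * y * e o b := by
  rw [amplify, Finset.sum_mul, Finset.sum_eq_single a]
  · rw [mul_assoc, he.mul_self]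
  · intro i _ hi
    rw [mul_assoc, he.mul_of_ne hi, mul_zero]
  · simp

theorem commute_amplify (he : IsMatrixUnits e) (o a b : ι) (y : R) :
    Commute (e a b) (amplify e o y) :=
  (he.mul_amplify o a b y).trans (he.amplify_mul o a b y).symm

/-- With its neighbours, this makes amplification a star-isomorphism from the corner at `o` onto the
commutant of `e`. -/
theorem amplify_mul_amplify (he : IsMatrixUnits e) (o : ι) (y z : R) :
    amplify e o y * amplify e o z = amplify e o (y * e o o * z) := by
  conv_lhs => rw [amplify, Finset.sum_mul]
  refine Finset.sum_congr rfl fun i _ => ?_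
  rw [mul_assoc, he.mul_amplify]
  simp only [mul_assoc]

theorem star_amplify (he : IsMatrixUnits e) (o : ι) (y : R) :
    star (amplify e o y) = amplify e o (star y) := by
  simp only [amplify, star_sum, star_mul, he.star_eq, mul_assoc]

theorem amplify_of_commute (he : IsMatrixUnits e) (o : ι) {y : R}
    (hy : ∀ i j, Commute (e i j) y) : amplify e o y = y := by
  have : ∀ i, e i o * y * e o i = y * e i i := fun i => by
    rw [(hy i o).eq, mul_assoc, he.mul_self]
  rw [amplify, Finset.sum_congr rfl fun i _ => this i, ← Finset.mul_sum, he.sum_eq, mul_one]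

theorem amplify_one (he : IsMatrixUnits e) (o : ι) : amplify e o 1 = 1 :=
  he.amplify_of_commute o fun _ _ => Commute.one_right _

theorem amplify_corner (he : IsMatrixUnits e) (o : ι) (y : R) :
    amplify e o (e o o * y * e o o) = amplify e o y := by
  refine Finset.sum_congr rfl fun i _ => ?_
  rw [← mul_assoc, ← mul_assoc, he.mul_self, mul_assoc _ (e o o), he.mul_self]

end IsMatrixUnits

/-! ### Commutants in full matrix algebras -/

open Matrix in
/-- A self-adjoint idempotent matrix is the range projection of an isometry. -/
theorem exists_isometry_of_projection {L : ℕ} {P : Matrix (Fin L) (Fin L) ℂ}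
    (hP : P.IsHermitian) (hPP : P * P = P) :
    ∃ (m : ℕ) (V : Matrix (Fin L) (Fin m) ℂ), V * Vᴴ = P ∧ Vᴴ * V = 1 := by
  set U : Matrix (Fin L) (Fin L) ℂ := ↑hP.eigenvectorUnitary with hU
  have hUU : Uᴴ * U = 1 := by
    have := Unitary.coe_star_mul_self hP.eigenvectorUnitary
    simpa [Matrix.star_eq_conjTranspose] using this
  have hUU' : U * Uᴴ = 1 := mul_eq_one_comm.mp hUU
  have hspec : P = U * diagonal (fun i => (hP.eigenvalues i : ℂ)) * Uᴴ := by
    have := hP.spectral_theorem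
    rw [Unitary.conjStarAlgAut_apply] at this
    exact this
  have hlam : ∀ i, (hP.eigenvalues i : ℂ) * hP.eigenvalues i = hP.eigenvalues i := by
    have hd : diagonal (fun i => (hP.eigenvalues i : ℂ)) = Uᴴ * P * U := by
      conv_rhs => rw [hspec]
      simp only [Matrix.mul_assoc, hUU, Matrix.mul_one]
      rw [← Matrix.mul_assoc, hUU, Matrix.one_mul]
    have : diagonal (fun i => (hP.eigenvalues i : ℂ)) * diagonal (fun i => (hP.eigenvalues i : ℂ))
        = diagonal (fun i => (hP.eigenvalues i : ℂ)) := by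
      rw [hd]
      calc Uᴴ * P * U * (Uᴴ * P * U) = Uᴴ * (P * (U * Uᴴ) * P) * U := by
            simp only [Matrix.mul_assoc]
        _ = _ := by rw [hUU', Matrix.mul_one, hPP]
    rw [diagonal_mul_diagonal] at this
    exact fun i => congrFun (diagonal_injective this) i
  -- The eigenvalues are 0 or 1; the eigenvectors for 1 form the columns of the isometry.
  let κ := {i : Fin L // (hP.eigenvalues i : ℂ) ≠ 0}
  let s : Fin (Fintype.card κ) ≃ κ := (Fintype.equivFin κ).symm
  refine ⟨Fintype.card κ, U.submatrix id (fun j => (s j : Fin L)), ?_, ?_⟩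
  · conv_rhs => rw [hspec]
    ext a b
    have h1 : (U * diagonal (fun i => (hP.eigenvalues i : ℂ)) * Uᴴ) a b
        = ∑ i, (if (hP.eigenvalues i : ℂ) ≠ 0 then U a i * star (U b i) else 0) := by
      rw [Matrix.mul_apply]
      refine Finset.sum_congr rfl fun i _ => ?_
      rw [mul_diagonal, conjTranspose_apply]
      split_ifs with h
      · have : (hP.eigenvalues i : ℂ) = 1 := by
          have := hlam i
          field_simp at this
          exact this
        rw [this, mul_one]
      · push Not at h
        rw [h, mul_zero, zero_mul]
    rw [h1, ← Finset.sum_filter, Matrix.mul_apply]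
    simp only [submatrix_apply, id, conjTranspose_apply]
    rw [s.sum_comp (fun k : κ => U a k * star (U b k))]
    exact (Finset.sum_subtype _ (by simp) (fun k => U a k * star (U b k))).symm
  · ext a b
    have h := congrFun (congrFun hUU (s a)) (s b)
    rw [Matrix.mul_apply] at h ⊢
    simp only [submatrix_apply, id, conjTranspose_apply, one_apply] at h ⊢
    rw [h]
    simp [Subtype.val_inj]

open Matrix in
/-- The commutant of the image of `M_n` in `M_L` contains matrix units of size `L / n`. -/
theorem exists_matrixUnits_commute {n L : ℕ} (hn : 0 < n)
    (f : Matrix (Fin n) (Fin n) ℂ →⋆ₐ[ℂ] Matrix (Fin L) (Fin L) ℂ) :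
    ∃ (m : ℕ) (e : Fin m → Fin m → Matrix (Fin L) (Fin L) ℂ), L = n * m ∧
      IsMatrixUnits e ∧ ∀ i j x, Commute (e i j) (f x) := by
  let o : Fin n := ⟨0, hn⟩
  set F : Fin n → Fin n → Matrix (Fin L) (Fin L) ℂ := fun i j => f (single i j 1) with hF
  have hFu : IsMatrixUnits F := isMatrixUnits_single.map f
  obtain ⟨m, V, hV, hV'⟩ := exists_isometry_of_projection (P := F o o) (hFu.star_eq o o)
    (hFu.mul_self o o o)
  have hVP : Vᴴ * F o o = Vᴴ := by rw [← hV, ← Matrix.mul_assoc, hV', Matrix.one_mul]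
  -- `V` identifies `M_m` with the corner at `F o o`, and amplification carries this corner into the
  -- commutant of the `F i j`.
  set Φ : Matrix (Fin m) (Fin m) ℂ → Matrix (Fin L) (Fin L) ℂ :=
    fun X => amplify F o (V * X * Vᴴ) with hΦ
  have hmul : ∀ X Y, Φ X * Φ Y = Φ (X * Y) := by
    intro X Y
    simp only [hΦ]
    rw [hFu.amplify_mul_amplify]
    congr 1
    calc V * X * Vᴴ * F o o * (V * Y * Vᴴ) = V * X * (Vᴴ * F o o) * (V * Y * Vᴴ) := by
          simp only [Matrix.mul_assoc]
      _ = V * X * (Vᴴ * V) * Y * Vᴴ := by rw [hVP]; simp only [Matrix.mul_assoc]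
      _ = V * (X * Y) * Vᴴ := by rw [hV']; simp only [Matrix.mul_assoc, Matrix.one_mul]
  refine ⟨m, fun s t => Φ (single s t 1), ?_, ⟨?_, ?_, ?_⟩, ?_⟩
  -- Each `F i i` is equivalent to `F o o` and so has trace `m`; the `n` of them add up to the unit.
  · have h1 : (1 : Matrix (Fin L) (Fin L) ℂ).trace = ∑ i, (F i i).trace := by
      rw [← hFu.sum_eq, Matrix.trace_sum]
    have h2 : ∀ i, (F i i).trace = m := by
      intro i
      rw [← hFu.mul_self i o i, Matrix.trace_mul_comm, hFu.mul_self, ← hV, Matrix.trace_mul_comm, hV']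
      simp
    simp only [h2, trace_one, Fintype.card_fin, Finset.sum_const, Finset.card_univ,
      nsmul_eq_mul] at h1
    exact_mod_cast h1
  · intro i j k l
    simp only [hmul]
    rw [isMatrixUnits_single.mul]
    split_ifs
    · rfl
    · simp [hΦ, amplify]
  · intro i j
    simp only [hΦ]
    rw [hFu.star_amplify]
    simp only [Matrix.star_eq_conjTranspose, conjTranspose_mul, conjTranspose_conjTranspose,
      conjTranspose_single, star_one, Matrix.mul_assoc]
  · have : ∑ i, Φ (single i i 1) = Φ (∑ i, single i i 1) := by
      simp only [hΦ, amplify, Matrix.mul_sum, Matrix.sum_mul]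
      rw [Finset.sum_comm]
    rw [this, (isMatrixUnits_single (ι := Fin m)).sum_eq]
    simp only [hΦ, Matrix.mul_one, hV]
    rw [← hFu.amplify_one o, ← hFu.amplify_corner o 1, mul_one, hFu.mul_self]
  · intro i j x
    rw [matrix_eq_sum_single x, map_sum]
    refine Commute.sum_right _ _ _ fun a _ => ?_
    rw [map_sum]
    refine Commute.sum_right _ _ _ fun b _ => ?_
    have : single a b (x a b) = x a b • single a b (1 : ℂ) := by simp
    rw [this, map_smul]
    refine Commute.smul_right ?_ _
    exact (hFu.commute_amplify o a b _).symm

/-! ### Real rank zero in the commutant of matrix units -/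

/-- Invertibility of the Schur complement of `b` with respect to an idempotent `p`. -/
theorem schurComplement_mul_corner {R : Type*} [Ring R] {p b b' m : R} (hp : p * p = p)
    (hb : b * b' = 1) (hm : m * ((1 - p) * b * (1 - p) + p) = 1) :
    p * ((b - b * (1 - p) * m * (1 - p) * b) * p * b') * p = p := by
  have h0 : (1 - p) * p = 0 := by rw [sub_mul, one_mul, hp, sub_self]
  have hq : (1 - p) * (1 - p) = 1 - p := by rw [mul_sub, mul_one, h0, sub_zero]
  have hmp : m * p = p := by
    have : m * ((1 - p) * b * (1 - p) + p) * p = p := by rw [hm, one_mul]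
    rwa [mul_assoc, add_mul, mul_assoc _ (1 - p) p, h0, mul_zero, zero_add, hp] at this
  have hmq : m * ((1 - p) * b * (1 - p)) = 1 - p := by
    rw [mul_add, hmp] at hm
    exact eq_sub_of_add_eq hm
  -- Trading `p * b'` for this difference makes the product `b * b' = 1` appear.
  have hpb : p * b' = b' - (1 - p) * b' := by noncomm_ring
  calc p * ((b - b * (1 - p) * m * (1 - p) * b) * p * b') * p
      = p * ((b - b * (1 - p) * m * (1 - p) * b) * (p * b')) * p := by simp only [mul_assoc]
    _ = p * (b * b') * p - p * b * (1 - p) * b' * p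
        - p * b * (1 - p) * m * ((1 - p) * (b * b')) * p
        + p * b * (1 - p) * (m * ((1 - p) * b * (1 - p))) * b' * p := by
          rw [hpb]; noncomm_ring
    _ = p := by
          rw [hmq, hb, mul_one, mul_one, hp, mul_assoc _ (1 - p) p, h0, mul_zero, sub_zero,
            mul_assoc _ (1 - p) (1 - p), hq, sub_add_cancel]

section Commutant

variable {A : Type u} [CStarAlgebra A] {ι : Type*} [Fintype ι] [DecidableEq ι] {e : ι → ι → A}

/-- If the invertible self-adjoint elements are dense, then so they are in the commutant of a
system of matrix units. -/
theorem IsMatrixUnits.exists_isUnit_commute (he : IsMatrixUnits e) (o : ι)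
    (hA : ∀ a : A, IsSelfAdjoint a → ∀ ε : ℝ, 0 < ε → ∃ b, IsSelfAdjoint b ∧ ‖b - a‖ < ε ∧ IsUnit b)
    {x : A} (hx : IsSelfAdjoint x) (hxe : ∀ i j, Commute (e i j) x) {ε : ℝ} (hε : 0 < ε) :
    ∃ h : A, IsSelfAdjoint h ∧ (∀ i j, Commute (e i j) h) ∧ ‖h - x‖ < ε ∧ IsUnit h := by
  set p := e o o with hp
  have hps : IsSelfAdjoint p := he.star_eq o o
  have hpp : p * p = p := he.mul_self o o o
  have hqs : IsSelfAdjoint (1 - p) := (IsSelfAdjoint.one A).sub hps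
  have hqp : (1 - p) * p = 0 := by rw [sub_mul, one_mul, hpp, sub_self]
  have hqq : (1 - p) * (1 - p) = 1 - p := by rw [mul_sub, mul_one, hqp, sub_zero]
  have hpx : p * x = x * p := hxe o o
  -- The corner of `x`, completed by `1 - p`: the complementary block is invertible, and stays so
  -- for elements near `a`.
  set a := x * p + (1 - p) with ha
  have has : IsSelfAdjoint a := by
    refine IsSelfAdjoint.add ?_ hqs
    rw [IsSelfAdjoint, star_mul, hps.star_eq, hx.star_eq, hpx]
  have hqa : (1 - p) * a = 1 - p := by
    rw [ha, mul_add, hqq, ← hpx, ← mul_assoc, hqp, zero_mul, zero_add]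
  have hcomp : (1 - p) * a * (1 - p) + p = 1 := by rw [hqa, hqq, sub_add_cancel]
  let r : A → A := fun b => (1 - p) * b * (1 - p) + p
  have hr : Continuous r := by fun_prop
  have hra : r a = 1 := hcomp
  -- The corner of `s b` at `p` is the Schur complement of `b`; the summand `p` in `r b` allows the
  -- block to be inverted in `A`.
  let s : A → A := fun b => b - b * (1 - p) * Ring.inverse (r b) * (1 - p) * b
  have hs : ContinuousAt s a := by
    have h1 : ContinuousAt (fun b => Ring.inverse (r b)) a := by
      refine ContinuousAt.comp (g := Ring.inverse) ?_ hr.continuousAt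
      rw [hra]
      exact NormedRing.inverse_continuousAt (1 : Aˣ)
    fun_prop
  have hG : ContinuousAt (fun b => amplify e o (s b)) a := by
    unfold amplify
    fun_prop
  have hGa : amplify e o (s a) = x := by
    rw [← he.amplify_corner, ← hp]
    have h1 : p * s a * p = x * p := by
      have hap : a * p = x * p := by rw [ha, add_mul, mul_assoc, hpp, hqp, add_zero]
      calc p * s a * p
          = p * (a * p) - p * a * (1 - p) * Ring.inverse (r a) * ((1 - p) * a * p) := by
            simp only [s]; noncomm_ring
        _ = x * p := by rw [hqa, hqp, mul_zero, sub_zero, hap, ← mul_assoc, hpx, mul_assoc, hpp]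
    have h2 : p * x * p = x * p := by rw [hpx, mul_assoc, hpp]
    rw [h1, ← h2, hp, he.amplify_corner, he.amplify_of_commute o hxe]
  have hev1 : ∀ᶠ b in nhds a, ‖amplify e o (s b) - x‖ < ε := by
    have := Metric.tendsto_nhds.mp hG ε hε
    simpa only [hGa, dist_eq_norm] using this
  have hev2 : ∀ᶠ b in nhds a, IsUnit (r b) := by
    refine hr.continuousAt.eventually ?_
    rw [hra]
    exact Units.nhds 1
  obtain ⟨δ, hδ, hball⟩ := Metric.eventually_nhds_iff.mp (hev1.and hev2)
  obtain ⟨b, hbs, hba, hbu⟩ := hA a has δ hδ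
  obtain ⟨hb1, hb2⟩ := hball (y := b) (by rwa [dist_eq_norm])
  have hsb : IsSelfAdjoint (s b) := by
    have hrb : IsSelfAdjoint (r b) := by
      refine IsSelfAdjoint.add ?_ hps
      rw [IsSelfAdjoint, star_mul, star_mul, hqs.star_eq, hbs.star_eq, mul_assoc]
    refine hbs.sub ?_
    rw [IsSelfAdjoint]
    simp only [star_mul, hqs.star_eq, hbs.star_eq, ← Ring.inverse_star, hrb.star_eq, mul_assoc]
  have hsa : IsSelfAdjoint (amplify e o (s b)) := by
    rw [IsSelfAdjoint, he.star_amplify, hsb.star_eq]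
  refine ⟨amplify e o (s b), hsa, fun i j => he.commute_amplify o i j _, hb1, ?_⟩
  -- The corner of the inverse of `b` inverts the Schur complement. A right inverse suffices: its
  -- adjoint is a left inverse, by self-adjointness.
  have hright : amplify e o (s b) * amplify e o (Ring.inverse b) = 1 := by
    rw [he.amplify_mul_amplify, ← he.amplify_corner, ← hp,
      schurComplement_mul_corner hpp (Ring.mul_inverse_cancel b hbu)
      (Ring.inverse_mul_cancel _ hb2), ← he.amplify_one o,
      ← he.amplify_corner o 1, mul_one, ← hp, hpp]
  have hleft : star (amplify e o (Ring.inverse b)) * amplify e o (s b) = 1 := by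
    have := congrArg star hright
    rwa [star_mul, hsa.star_eq, star_one] at this
  exact isUnit_iff_exists_and_exists.mpr ⟨⟨_, hright⟩, ⟨_, hleft⟩⟩

/-- Finitely many points can be removed from the spectrum by a small perturbation in the
commutant of a system of matrix units. -/
theorem IsMatrixUnits.exists_notMem_spectrum_commute (he : IsMatrixUnits e) (o : ι)
    (hA : ∀ a : A, IsSelfAdjoint a → ∀ ε : ℝ, 0 < ε → ∃ b, IsSelfAdjoint b ∧ ‖b - a‖ < ε ∧ IsUnit b)
    {x : A} (hx : IsSelfAdjoint x) (hxe : ∀ i j, Commute (e i j) x) (T : Finset ℝ)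
    {ε : ℝ} (hε : 0 < ε) :
    ∃ h : A, IsSelfAdjoint h ∧ (∀ i j, Commute (e i j) h) ∧ ‖h - x‖ < ε ∧
      ∀ t ∈ T, t ∉ spectrum ℝ h := by
  induction T using Finset.induction_on generalizing ε with
  | empty => exact ⟨x, hx, hxe, by simpa using hε, by simp⟩
  | insert t T _ ih =>
    obtain ⟨h, hh, hhe, hhx, hT⟩ := ih (half_pos hε)
    -- Avoiding a point with the spectrum is an open condition, so the points already removed stay
    -- removed.
    have hev : ∀ᶠ y in nhds h, ∀ t ∈ T, t ∉ spectrum ℝ y := by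
      rw [Filter.eventually_all_finset]
      intro t ht
      have h1 : IsUnit (algebraMap ℝ A t - h) := spectrum.notMem_iff.mp (hT t ht)
      have h2 : ContinuousAt (fun y => algebraMap ℝ A t - y) h := by fun_prop
      filter_upwards [h2.eventually (Units.isOpen.mem_nhds h1)] with y hy
      exact spectrum.notMem_iff.mpr hy
    obtain ⟨δ, hδ, hball⟩ := Metric.eventually_nhds_iff.mp hev
    have hts : IsSelfAdjoint (algebraMap ℝ A t) := IsSelfAdjoint.algebraMap A (.all t)
    have htc : ∀ y : A, Commute y (algebraMap ℝ A t) := fun y => (Algebra.commutes t y).symm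
    obtain ⟨g, hg, hge, hgx, hgu⟩ := he.exists_isUnit_commute o hA (hts.sub hh)
      (fun i j => (htc _).sub_right (hhe i j)) (lt_min hδ (half_pos hε))
    have hd : ‖(algebraMap ℝ A t - g) - h‖ < min δ (ε / 2) := by
      rwa [show algebraMap ℝ A t - g - h = -(g - (algebraMap ℝ A t - h)) by abel, norm_neg]
    refine ⟨algebraMap ℝ A t - g, hts.sub hg, fun i j => (htc _).sub_right (hge i j), ?_, ?_⟩
    · calc ‖algebraMap ℝ A t - g - x‖ = ‖(algebraMap ℝ A t - g - h) + (h - x)‖ := by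
            rw [sub_add_sub_cancel]
        _ ≤ ‖algebraMap ℝ A t - g - h‖ + ‖h - x‖ := norm_add_le _ _
        _ < ε := by linarith [hd.trans_le (min_le_right _ _)]
    · intro r hr
      rcases Finset.mem_insert.mp hr with rfl | hr
      · rw [spectrum.notMem_iff]
        simpa using hgu
      · exact hball (by rw [dist_eq_norm]; exact hd.trans_le (min_le_left _ _)) r hr

/-- If the invertible self-adjoint elements are dense, then the self-adjoint elements of finite
spectrum are dense among the self-adjoint elements commuting with a system of matrix units. -/
theorem IsMatrixUnits.exists_finite_spectrum_commute (he : IsMatrixUnits e) (o : ι)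
    (hA : ∀ a : A, IsSelfAdjoint a → ∀ ε : ℝ, 0 < ε → ∃ b, IsSelfAdjoint b ∧ ‖b - a‖ < ε ∧ IsUnit b)
    {x : A} (hx : IsSelfAdjoint x) (hxe : ∀ i j, Commute (e i j) x) {ε : ℝ} (hε : 0 < ε) :
    ∃ h : A, IsSelfAdjoint h ∧ (∀ i j, Commute (e i j) h) ∧ ‖h - x‖ < ε ∧
      (spectrum ℝ h).Finite := by
  set δ := ε / 3 with hδ
  have hδ0 : 0 < δ := by positivity
  -- The grid of the `δ * k` with `|k| ≤ K` covers the range of the spectrum of `h`. The factor `‖(1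
  -- : A)‖` is kept because `A` may be zero.
  obtain ⟨K, hK⟩ := exists_nat_gt ((‖x‖ + δ) * ‖(1 : A)‖ / δ)
  rw [div_lt_iff₀ hδ0] at hK
  obtain ⟨h, hh, hhe, hhx, hT⟩ := he.exists_notMem_spectrum_commute o hA hx hxe
    ((Finset.Icc (-K : ℤ) K).image fun k : ℤ => δ * k) hδ0
  have hbound : ∀ t ∈ spectrum ℝ h, |t| ≤ K * δ := by
    intro t ht
    have h1 := spectrum.norm_le_norm_mul_of_mem ht
    have h2 : ‖h‖ ≤ ‖x‖ + δ := by
      calc ‖h‖ = ‖x + (h - x)‖ := by rw [add_sub_cancel]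
        _ ≤ ‖x‖ + ‖h - x‖ := norm_add_le _ _
        _ ≤ _ := by linarith
    rw [Real.norm_eq_abs] at h1
    nlinarith [mul_le_mul_of_nonneg_right h2 (norm_nonneg (1 : A))]
  have hgap : ∀ t ∈ spectrum ℝ h, ∀ k : ℤ, t ≠ δ * k := by
    rintro t ht k rfl
    have h1 := hbound _ ht
    rw [abs_mul, abs_of_pos hδ0, mul_comm, mul_le_mul_iff_left₀ hδ0] at h1
    have h2 : |k| ≤ K := by exact_mod_cast h1
    exact hT _ (Finset.mem_image.mpr ⟨k, Finset.mem_Icc.mpr (abs_le.mp h2), rfl⟩) ht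
  -- Rounding down to the grid is locally constant off the grid, hence continuous on the spectrum,
  -- and moves points by at most `δ`.
  let g : ℝ → ℝ := fun t => δ * ⌊t / δ⌋
  have hg : ContinuousOn g (spectrum ℝ h) := by
    intro t ht
    refine ContinuousAt.continuousWithinAt ?_
    have hl : (⌊t / δ⌋ : ℝ) < t / δ := by
      refine lt_of_le_of_ne (Int.floor_le _) fun h => hgap t ht ⌊t / δ⌋ ?_
      rw [h]; field_simp
    have hev : ∀ᶠ y in nhds t, g y = g t := by
      have hc : ContinuousAt (fun y : ℝ => y / δ) t := by fun_prop
      filter_upwards [hc.eventually (Ioo_mem_nhds hl (Int.lt_floor_add_one _))] with y hy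
      have : ⌊y / δ⌋ = ⌊t / δ⌋ := Int.floor_eq_iff.mpr ⟨hy.1.le, hy.2⟩
      simp only [g, this]
    exact continuousAt_const.congr (hev.mono fun _ h => h.symm)
  refine ⟨cfc g h, cfc_predicate g h, fun i j => ((hhe i j).symm.cfc_real g).symm, ?_, ?_⟩
  · have h1 : ‖cfc g h - h‖ ≤ δ := by
      have : cfc g h - h = cfc (fun t => g t - t) h := by
        rw [cfc_sub g (fun t => t) h, cfc_id' ℝ h]
      rw [this]
      refine norm_cfc_le hδ0.le fun t _ => ?_
      have h3 : δ * (t / δ) = t := by field_simp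
      have h4 := mul_le_mul_of_nonneg_left (Int.floor_le (t / δ)) hδ0.le
      have h5 := mul_le_mul_of_nonneg_left (Int.lt_floor_add_one (t / δ)).le hδ0.le
      rw [Real.norm_eq_abs, abs_le]
      constructor <;> simp only [g] <;> linarith
    calc ‖cfc g h - x‖ = ‖(cfc g h - h) + (h - x)‖ := by rw [sub_add_sub_cancel]
      _ ≤ ‖cfc g h - h‖ + ‖h - x‖ := norm_add_le _ _
      _ < ε := by linarith
  · rw [cfc_map_spectrum g h]
    refine (((Set.finite_Icc (-K - 1 : ℤ) K).image fun k : ℤ => δ * k)).subset ?_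
    rintro _ ⟨t, ht, rfl⟩
    refine ⟨⌊t / δ⌋, ?_, rfl⟩
    have h1 := abs_le.mp (hbound t ht)
    rw [Set.mem_Icc]
    constructor
    · rw [Int.le_floor, le_div_iff₀ hδ0]
      push_cast
      nlinarith
    · have : ((⌊t / δ⌋ : ℤ) : ℝ) ≤ K :=
        (Int.floor_le _).trans ((div_le_iff₀ hδ0).mpr h1.2)
      exact_mod_cast this

end Commutant

/-! ### The two generating perturbations -/

/-- A polynomial without constant term maps an element of a subalgebra into the subalgebra. -/
theorem aeval_mem_of_coeff_zero {A : Type u} [CStarAlgebra A] (S : NonUnitalStarSubalgebra ℂ A)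
    {b : A} (hb : b ∈ S) (q : Polynomial ℝ) (hq : q.coeff 0 = 0) : Polynomial.aeval b q ∈ S := by
  have hpow : ∀ n : ℕ, b ^ (n + 1) ∈ S := by
    intro n
    induction n with
    | zero => simpa using hb
    | succ n ih => rw [pow_succ]; exact mul_mem ih hb
  rw [Polynomial.aeval_eq_sum_range]
  refine sum_mem fun n _ => ?_
  cases n with
  | zero => rw [hq, zero_smul]; exact zero_mem S
  | succ n =>
    rw [← Complex.coe_smul]
    exact SMulMemClass.smul_mem _ (hpow n)

/-- A polynomial that is constant on the spectrum of `h + c` is constant at `h + c`. -/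
theorem aeval_add_algebraMap_of_eval_eq {A : Type u} [CStarAlgebra A] {h : A}
    (hh : IsSelfAdjoint h) (q : Polynomial ℝ) {c r : ℝ}
    (hq : ∀ s ∈ spectrum ℝ h, q.eval (s + c) = r) :
    Polynomial.aeval (h + algebraMap ℝ A c) q = algebraMap ℝ A r := by
  have h1 : Polynomial.aeval (h + algebraMap ℝ A c) q =
      Polynomial.aeval h (q.comp (Polynomial.X + Polynomial.C c)) := by
    rw [Polynomial.aeval_comp, map_add, Polynomial.aeval_X, Polynomial.aeval_C]
  have h2 : (spectrum ℝ h).EqOn (q.comp (Polynomial.X + Polynomial.C c)).eval (fun _ => r) := by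
    intro s hs
    simpa using hq s hs
  rw [h1, ← cfc_polynomial _ h hh, cfc_congr h2, cfc_const r h hh]

section Commutant

variable {A : Type u} [CStarAlgebra A] {ι : Type*} [Fintype ι] [DecidableEq ι] {e : ι → ι → A}

/-- A generic diagonal perturbation of an element of finite spectrum in the commutant of matrix
units generates the diagonal matrix units. -/
theorem IsMatrixUnits.exists_diagonal_perturbation (he : IsMatrixUnits e) {h : A}
    (hh : IsSelfAdjoint h) (hhe : ∀ i j, Commute (e i j) h) (hfin : (spectrum ℝ h).Finite)
    {ε : ℝ} (hε : 0 < ε) :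
    ∃ b : A, IsSelfAdjoint b ∧ ‖b - h‖ < ε ∧
      ∀ S : NonUnitalStarSubalgebra ℂ A, b ∈ S → ∀ i, e i i ∈ S := by
  classical
  obtain ⟨ν, hν0, hνinj⟩ : ∃ ν : ι → ℝ, (∀ i, ν i ≠ 0) ∧ Function.Injective ν := by
    refine ⟨fun i => (Fintype.equivFin ι i : ℕ) + 1, fun i => by positivity, fun i j hij => ?_⟩
    simp only [add_left_inj, Nat.cast_inj] at hij
    exact (Fintype.equivFin ι).injective (Fin.ext hij)
  let Λ : Finset ℝ := hfin.toFinset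
  set T : A := ∑ i, ν i • e i i with hT
  have hTs : IsSelfAdjoint T := by
    rw [IsSelfAdjoint, hT, star_sum]
    exact Finset.sum_congr rfl fun i _ => by rw [star_smul, he.star_eq, star_trivial]
  have hTe : ∀ i, T * e i i = ν i • e i i := by
    intro i
    rw [hT, Finset.sum_mul, Finset.sum_eq_single i]
    · rw [smul_mul_assoc, he.mul_self]
    · intro j _ hj
      rw [smul_mul_assoc, he.mul_of_ne hj, smul_zero]
    · simp
  -- The finitely many `η` for which shifted spectra of two different blocks meet, or one of them
  -- contains 0.
  let bad : Finset ℝ :=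
    (Λ ×ˢ Λ ×ˢ (Finset.univ : Finset (ι × ι))).image
      (fun z => (z.2.1 - z.1) / (ν z.2.2.1 - ν z.2.2.2)) ∪
    (Λ ×ˢ (Finset.univ : Finset ι)).image (fun z => -z.1 / ν z.2)
  obtain ⟨η, ⟨hη0, hηlt⟩, hηbad⟩ : ∃ η ∈ Set.Ioo 0 (ε / (‖T‖ + 1)), η ∉ bad :=
    (Set.Ioo_infinite (by positivity)).exists_notMem_finset bad
  have hsep : ∀ s ∈ Λ, ∀ t ∈ Λ, ∀ i j, s + η * ν i = t + η * ν j → i = j := by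
    intro s hs t ht i j hij
    by_contra hne
    refine hηbad (Finset.mem_union_left _ (Finset.mem_image.mpr ⟨(s, t, i, j), by simp [hs, ht], ?_⟩))
    have : ν i - ν j ≠ 0 := sub_ne_zero.mpr (hνinj.ne hne)
    rw [div_eq_iff this]
    linarith
  have hne0 : ∀ s ∈ Λ, ∀ i, s + η * ν i ≠ 0 := by
    intro s hs i hi
    refine hηbad (Finset.mem_union_right _ (Finset.mem_image.mpr ⟨(s, i), by simp [hs], ?_⟩))
    rw [div_eq_iff (hν0 i)]
    linarith
  set b := h + η • T with hb
  have hbe : ∀ i, b * e i i = e i i * (h + algebraMap ℝ A (η * ν i)) := by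
    intro i
    rw [hb, add_mul, smul_mul_assoc, hTe, smul_smul, mul_add, (hhe i i).eq,
      ← Algebra.commutes, ← Algebra.smul_def]
  have hpe : ∀ (q : Polynomial ℝ) (i : ι), Polynomial.aeval b q * e i i =
      e i i * Polynomial.aeval (h + algebraMap ℝ A (η * ν i)) q := by
    intro q i
    induction q using Polynomial.induction_on' with
    | add q r hq hr => rw [map_add, map_add, add_mul, mul_add, hq, hr]
    | monomial n c =>
      have hpow : ∀ n : ℕ, b ^ n * e i i = e i i * (h + algebraMap ℝ A (η * ν i)) ^ n := by
        intro n
        exact (SemiconjBy.pow_right (show SemiconjBy (e i i) _ _ from (hbe i).symm) n).symm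
      rw [Polynomial.aeval_monomial, Polynomial.aeval_monomial, mul_assoc, hpow, ← mul_assoc,
        ← mul_assoc, Algebra.commutes]
  refine ⟨b, hh.add (.smul (.all η) hTs), ?_, ?_⟩
  · rw [hb, add_sub_cancel_left, norm_smul, Real.norm_eq_abs, abs_of_pos hη0]
    rw [lt_div_iff₀ (by positivity)] at hηlt
    nlinarith
  · intro S hbS j
    -- The node 0 forces `q` to have no constant term, as `S` need not contain the unit; on block
    -- `i`, `q` takes the value 1 if `i = j` and 0 otherwise.
    let nodes : Finset ℝ :=
      insert 0 ((Λ ×ˢ (Finset.univ : Finset ι)).image fun z => z.1 + η * ν z.2)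
    let q : Polynomial ℝ := Lagrange.interpolate nodes id
      fun x => if ∃ s ∈ Λ, x = s + η * ν j then 1 else 0
    have hq0 : q.coeff 0 = 0 := by
      rw [Polynomial.coeff_zero_eq_eval_zero]
      refine (Lagrange.eval_interpolate_at_node (v := id) (i := (0 : ℝ)) _ Function.injective_id.injOn
        (Finset.mem_insert_self _ _)).trans (if_neg ?_)
      rintro ⟨s, hs, h0⟩
      exact hne0 s hs j h0.symm
    have hqe : ∀ s ∈ Λ, ∀ i, q.eval (s + η * ν i) = if i = j then 1 else 0 := by
      intro s hs i
      have hmem : s + η * ν i ∈ nodes :=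
        Finset.mem_insert_of_mem (Finset.mem_image.mpr ⟨(s, i), by simp [hs], rfl⟩)
      refine (Lagrange.eval_interpolate_at_node (v := id) (i := s + η * ν i) _
        Function.injective_id.injOn hmem).trans ?_
      split_ifs with h1 h2 h2
      · rfl
      · obtain ⟨t, ht, hst⟩ := h1
        exact absurd (hsep s hs t ht i j hst) h2
      · exact absurd ⟨s, hs, by rw [h2]⟩ h1
      · rfl
    have hqh : ∀ i, Polynomial.aeval (h + algebraMap ℝ A (η * ν i)) q = if i = j then 1 else 0 := by
      intro i
      rw [aeval_add_algebraMap_of_eval_eq hh q (c := η * ν i) (r := if i = j then 1 else 0)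
        fun s hs => hqe s (hfin.mem_toFinset.mpr hs) i]
      split_ifs
      · exact map_one _
      · exact map_zero _
    have hfinal : Polynomial.aeval b q = e j j := by
      rw [← mul_one (Polynomial.aeval b q), ← he.sum_eq, Finset.mul_sum, Finset.sum_eq_single j]
      · rw [hpe, hqh, if_pos rfl, mul_one]
      · intro i _ hi
        rw [hpe, hqh, if_neg hi, mul_zero]
      · simp
    rw [← hfinal]
    exact aeval_mem_of_coeff_zero S hbS q hq0

/-- In the presence of the diagonal matrix units, a small perturbation of `a` generates a given
element `c`, if `a` and `c` commute with a system of at least three-by-three matrix units. -/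
theorem IsMatrixUnits.exists_offDiagonal_perturbation (he : IsMatrixUnits e) {o k l : ι}
    (hok : o ≠ k) (hol : o ≠ l) (hkl : k ≠ l) {a c : A}
    (ha : IsSelfAdjoint a) (hae : ∀ i j, Commute (e i j) a) (hce : ∀ i j, Commute (e i j) c)
    {ε : ℝ} (hε : 0 < ε) :
    ∃ b : A, IsSelfAdjoint b ∧ ‖b - a‖ < ε ∧
      ∀ S : NonUnitalStarSubalgebra ℂ A, b ∈ S → (∀ i, e i i ∈ S) → c ∈ S := by
  -- The indices being distinct, the entries of `X` and `star X` occupy different off-diagonal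
  -- places; this is where size three is needed.
  set X : A := ∑ i ∈ Finset.univ.erase o, e o i + c * e k l with hX
  set δ : ℝ := ε / (‖X + star X‖ + 1) with hδ
  have hδ0 : 0 < δ := by positivity
  have hδne : (δ : ℂ) ≠ 0 := by exact_mod_cast hδ0.ne'
  have hce' : ∀ i j, Commute (e i j) (star c) := by
    intro i j
    have := (hce j i).star_star
    rwa [he.star_eq] at this
  have hcut : ∀ {y : A}, (∀ i j, Commute (e i j) y) → ∀ i j m n, e i i * (y * e m n) * e j j =
      if i = m ∧ j = n then y * e m n else 0 := by
    intro y hy i j m n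
    rw [← mul_assoc, (hy i i).eq, mul_assoc y, mul_assoc y, he.mul]
    split_ifs with h1 h2 h2
    · rw [h1, ← h2.2, he.mul_self]
    · rw [he.mul_of_ne fun h3 => h2 ⟨h1, h3.symm⟩, mul_zero]
    · exact absurd h2.1 h1
    · rw [zero_mul, mul_zero]
  have hcut1 : ∀ i j m n, e i i * e m n * e j j = if i = m ∧ j = n then e m n else 0 := by
    intro i j m n
    simpa using hcut (y := 1) (fun _ _ => Commute.one_right _) i j m n
  have hXs : star X = ∑ i ∈ Finset.univ.erase o, e i o + star c * e l k := by
    rw [hX, star_add, star_sum, star_mul, he.star_eq, (hce' l k).eq]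
    simp only [he.star_eq]
  -- As `a` commutes with the `e i i`, it is block diagonal and disappears from the off-diagonal
  -- corners.
  have hcutX : ∀ i j, i ≠ j → e i i * (a + δ • (X + star X)) * e j j =
      δ • (∑ m ∈ Finset.univ.erase o, (if i = o ∧ j = m then e o m else 0)
        + (if i = k ∧ j = l then c * e k l else 0)
        + (∑ m ∈ Finset.univ.erase o, (if i = m ∧ j = o then e m o else 0)
        + if i = l ∧ j = k then star c * e l k else 0)) := by
    intro i j hij
    have h1 : e i i * a * e j j = 0 := by rw [(hae i i).eq, mul_assoc, he.mul_of_ne hij, mul_zero]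
    rw [mul_add, add_mul, h1, zero_add, mul_smul_comm, smul_mul_assoc, hXs, hX]
    simp only [mul_add, add_mul, Finset.mul_sum, Finset.sum_mul, hcut1, hcut hce, hcut hce']
  refine ⟨a + δ • (X + star X), ha.add (.smul (.all δ) (.add_star_self X)), ?_, ?_⟩
  · rw [add_sub_cancel_left, norm_smul, Real.norm_eq_abs, abs_of_pos hδ0, hδ, div_mul_eq_mul_div,
      div_lt_iff₀ (by positivity)]
    nlinarith
  · intro S hbS heS
    have hscale : ∀ {y : A}, δ • y ∈ S → y ∈ S := by
      intro y hy
      rw [← Complex.coe_smul] at hy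
      have := SMulMemClass.smul_mem ((δ : ℂ)⁻¹) hy
      rwa [smul_smul, inv_mul_cancel₀ hδne, one_smul] at this
    have ho : ∀ i, e o i ∈ S := by
      intro i
      by_cases hi : o = i
      · rw [← hi]; exact heS o
      have h1 : e o o * (a + δ • (X + star X)) * e i i ∈ S := mul_mem (mul_mem (heS o) hbS) (heS i)
      rw [hcutX o i hi] at h1
      have h2 := hscale h1
      rw [Finset.sum_eq_single_of_mem i (by simp [Ne.symm hi]) (by
        intro m _ hm; rw [if_neg fun h => hm h.2.symm]),
        Finset.sum_eq_zero (fun m _ => by rw [if_neg fun h => hi h.2.symm])] at h2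
      simpa [hok, hol] using h2
    have ho' : ∀ i, e i o ∈ S := fun i => by rw [← he.star_eq]; exact star_mem (ho i)
    have hc : c * e k l ∈ S := by
      have h1 : e k k * (a + δ • (X + star X)) * e l l ∈ S := mul_mem (mul_mem (heS k) hbS) (heS l)
      rw [hcutX k l hkl] at h1
      have h2 := hscale h1
      simpa [hok.symm, hol.symm, hkl] using h2
    have hsum : c = ∑ i, e i o * e o k * (c * e k l) * (e l o * e o i) := by
      have h1 : ∀ i, e i o * e o k * (c * e k l) * (e l o * e o i) = c * e i i := by
        intro i
        rw [he.mul_self, he.mul_self, ← mul_assoc, (hce i k).eq, mul_assoc c, he.mul_self,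
          mul_assoc c, he.mul_self]
      rw [Finset.sum_congr rfl fun i _ => h1 i, ← Finset.mul_sum, he.sum_eq, mul_one]
    rw [hsum]
    exact sum_mem fun i _ => mul_mem (mul_mem (mul_mem (ho' i) (ho k)) hc)
      (mul_mem (ho' l) (ho i))

end Commutant

/-! ### Matrix units in UHF-algebras and in absorbing algebras -/

/-- In an infinite-dimensional UHF-algebra, the sizes of the matrix algebras are unbounded. -/
theorem exists_size_ge_of_not_finiteDimensional {D : Type v} [CStarAlgebra D]
    (hD : ¬ FiniteDimensional ℂ D) {n : ℕ → ℕ} {B : ℕ → StarSubalgebra ℂ D} (hB : Monotone B)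
    (hn : ∀ k, Nonempty (Matrix (Fin (n k)) (Fin (n k)) ℂ ≃⋆ₐ[ℂ] B k))
    (hdense : Dense (⋃ k, (B k : Set D))) (k N : ℕ) : ∃ l, k ≤ l ∧ N ≤ n l := by
  by_contra! hcon
  let W : ℕ → Submodule ℂ D := fun l => (B l).toSubalgebra.toSubmodule
  have hequiv : ∀ l, Nonempty (Matrix (Fin (n l)) (Fin (n l)) ℂ ≃ₗ[ℂ] W l) := fun l =>
    ⟨(hn l).some.toAlgEquiv.toLinearEquiv⟩
  have hfin : ∀ l, FiniteDimensional ℂ (W l) := fun l => (hequiv l).some.finiteDimensional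
  have hrank : ∀ l, Module.finrank ℂ (W l) = n l * n l := fun l => by
    rw [← (hequiv l).some.finrank_eq, Module.finrank_matrix]
    simp only [Fintype.card_fin, Module.finrank_self, mul_one]
  obtain ⟨l₀, hl₀, hmax⟩ : ∃ l₀, k ≤ l₀ ∧ ∀ l, k ≤ l → n l ≤ n l₀ := by
    have hne : (n '' Set.Ici k).Nonempty := ⟨n k, k, Set.mem_Ici.mpr le_rfl, rfl⟩
    have hbdd : BddAbove (n '' Set.Ici k) := by
      refine ⟨N, ?_⟩
      rintro _ ⟨l, hl, rfl⟩
      exact (hcon l hl).le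
    obtain ⟨l₀, hl₀, h⟩ := Nat.sSup_mem hne hbdd
    exact ⟨l₀, hl₀, fun l hl => by rw [h]; exact le_csSup hbdd ⟨l, hl, rfl⟩⟩
  -- Beyond a stage of maximal size the sequence is constant, so its dense union would be
  -- finite-dimensional, hence closed.
  have hle : ∀ l, (B l : Set D) ⊆ B l₀ := by
    intro l
    have h1 : W l₀ ≤ W (max l l₀) := fun x hx => hB (le_max_right l l₀) hx
    have h2 : W l₀ = W (max l l₀) := by
      refine Submodule.eq_of_le_of_finrank_le h1 ?_
      rw [hrank, hrank]
      have := hmax (max l l₀) (hl₀.trans (le_max_right _ _))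
      exact Nat.mul_le_mul this this
    intro x hx
    have : x ∈ W (max l l₀) := hB (le_max_left l l₀) hx
    rw [← h2] at this
    exact this
  have htop : W l₀ = ⊤ := by
    have hc : IsClosed (W l₀ : Set D) := Submodule.closed_of_finiteDimensional _
    have hd : Dense (W l₀ : Set D) := hdense.mono (Set.iUnion_subset hle)
    rw [← Submodule.coe_eq_univ, ← hc.closure_eq, hd.closure_eq]
  exact hD (Module.finite_def.mpr (htop ▸ (Module.Finite.iff_fg.mp (hfin l₀))))

/-- A UHF-algebra of infinite type is infinite-dimensional. -/
theorem IsUHFOfInfiniteType.not_finiteDimensional {D : Type v} [CStarAlgebra D]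
    (hD : IsUHFOfInfiniteType D) : ¬ FiniteDimensional ℂ D := by
  intro hfin
  obtain ⟨-, -, p, hp, htop⟩ := hD
  -- With `k` above the dimension of `D`, the `p ^ k` by `p ^ k` matrices are too large to embed.
  have hlt : ((Module.finrank ℂ D : ℕ) : ℕ∞) < supernaturalExponent D p := by
    rw [htop]; exact ENat.natCast_lt_top _
  rw [supernaturalExponent, lt_iSup_iff] at hlt
  obtain ⟨k, hk⟩ := hlt
  rw [lt_iSup_iff] at hk
  obtain ⟨⟨f, hf⟩, hk⟩ := hk
  have hk' : Module.finrank ℂ D < k := by exact_mod_cast hk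
  have h1 : Module.finrank ℂ (Matrix (Fin (p ^ k)) (Fin (p ^ k)) ℂ) ≤ Module.finrank ℂ D :=
    LinearMap.finrank_le_finrank_of_injective (f := f.toAlgHom.toLinearMap) hf
  rw [Module.finrank_matrix] at h1
  simp only [Fintype.card_fin, Module.finrank_self, mul_one] at h1
  have h2 : k < p ^ k := Nat.lt_pow_self hp.one_lt
  nlinarith

/-- Any matrix algebra of the sequence defining an infinite-dimensional UHF-algebra commutes with a
system of at least three-by-three matrix units. -/
theorem exists_matrixUnits_commute_of_uhf {D : Type v} [CStarAlgebra D]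
    (hD : ¬ FiniteDimensional ℂ D) {n : ℕ → ℕ} {B : ℕ → StarSubalgebra ℂ D} (hB : Monotone B)
    (hn : ∀ k, 0 < n k ∧ Nonempty (Matrix (Fin (n k)) (Fin (n k)) ℂ ≃⋆ₐ[ℂ] B k))
    (hdense : Dense (⋃ k, (B k : Set D))) (k : ℕ) :
    ∃ (m : ℕ) (e : Fin m → Fin m → D), 3 ≤ m ∧ IsMatrixUnits e ∧
      ∀ i j, ∀ x ∈ B k, Commute (e i j) x := by
  -- Since `n l = n k * m`, the factor 3 gives `m ≥ 3`.
  obtain ⟨l, hkl, hl⟩ := exists_size_ge_of_not_finiteDimensional hD hB (fun k => (hn k).2) hdense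
    k (3 * n k)
  obtain ⟨α⟩ := (hn k).2
  obtain ⟨β⟩ := (hn l).2
  let f : Matrix (Fin (n k)) (Fin (n k)) ℂ →⋆ₐ[ℂ] Matrix (Fin (n l)) (Fin (n l)) ℂ :=
    (β.symm : B l →⋆ₐ[ℂ] _).comp ((StarSubalgebra.inclusion (hB hkl)).comp (α : _ →⋆ₐ[ℂ] B k))
  obtain ⟨m, e, hm, he, hef⟩ := exists_matrixUnits_commute (hn k).1 f
  let g : Matrix (Fin (n l)) (Fin (n l)) ℂ →⋆ₐ[ℂ] D :=
    (B l).subtype.comp (β : _ →⋆ₐ[ℂ] B l)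
  refine ⟨m, fun i j => g (e i j), ?_, he.map g, ?_⟩
  · have h0 := (hn k).1
    rw [hm, mul_comm] at hl
    exact Nat.le_of_mul_le_mul_left hl h0
  · intro i j x hx
    have h1 : x = g (f (α.symm ⟨x, hx⟩)) := by
      simp [g, f]
    rw [h1]
    exact (hef i j _).map g

/-- If `A` absorbs an infinite-dimensional UHF-algebra, then finitely many elements of `A` can be
approximated by elements commuting with a system of at least three-by-three matrix units. -/
theorem exists_approx_commute_matrixUnits {A : Type u} [CStarAlgebra A] {D : Type v}
    [CStarAlgebra D] (hD : ¬ FiniteDimensional ℂ D) (hU : IsUHF D)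
    (ψ : A ⊗[ℂ] D →⋆ₐ[ℂ] A) (hψ : DenseRange ψ) {κ : Type*} [Finite κ] (a : κ → A) {ε : ℝ}
    (hε : 0 < ε) :
    ∃ (m : ℕ) (e : Fin m → Fin m → A) (a' : κ → A), 3 ≤ m ∧ IsMatrixUnits e ∧
      (∀ s i j, Commute (e i j) (a' s)) ∧ ∀ s, ‖a' s - a s‖ < ε := by
  obtain ⟨n, B, hB, hn, hdense⟩ := hU
  let ρ : D →⋆ₐ[ℂ] A := ψ.comp
    { (Algebra.TensorProduct.includeRight : D →ₐ[ℂ] A ⊗[ℂ] D) with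
      map_star' := fun d => by simp }
  have hρ : ∀ d, ρ d = ψ (1 ⊗ₜ d) := fun _ => rfl
  have hρc : Continuous ρ :=
    AddMonoidHomClass.continuous_of_bound ρ 1 fun d => by
      simpa using NonUnitalStarAlgHom.norm_apply_le ρ d
  -- The double commutant contains the image of `A ⊗ B k`, and whatever commutes with the generators
  -- commutes with all of it.
  let C : ℕ → Subalgebra ℂ A := fun k => Subalgebra.centralizer ℂ
    (Subalgebra.centralizer ℂ (Set.range (fun a : A => ψ (a ⊗ₜ 1)) ∪ ρ '' B k) : Set A)
  have hCmono : Monotone C := by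
    intro k l hkl
    refine Subalgebra.centralizer_le _ _ _ (Subalgebra.centralizer_le _ _ _ ?_)
    exact Set.union_subset_union_right _ (Set.image_mono (hB hkl))
  have hCsub : ∀ k, Set.range (fun a : A => ψ (a ⊗ₜ 1)) ∪ ρ '' B k ⊆ C k := fun k =>
    Set.subset_centralizer_centralizer
  let W : Submodule ℂ A := ⨆ k, (C k).toSubmodule
  have hWmem : ∀ x, x ∈ W ↔ ∃ k, x ∈ C k := by
    intro x
    exact Submodule.mem_iSup_of_directed _ (Monotone.directed_le fun k l h => hCmono h)
  have hpure : ∀ (x : A) (d : D), ψ (x ⊗ₜ d) ∈ W.topologicalClosure := by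
    intro x d
    have hcont : Continuous fun d => ψ (x ⊗ₜ 1) * ρ d := continuous_const.mul hρc
    have hmaps : Set.MapsTo (fun d => ψ (x ⊗ₜ 1) * ρ d) (⋃ k, (B k : Set D)) (W : Set A) := by
      intro y hy
      obtain ⟨k, hk⟩ := Set.mem_iUnion.mp hy
      exact (hWmem _).mpr ⟨k, mul_mem (hCsub k (Or.inl ⟨x, rfl⟩))
        (hCsub k (Or.inr ⟨y, hk, rfl⟩))⟩
    have h1 := map_mem_closure hcont (hdense d) hmaps
    have h2 : ψ (x ⊗ₜ d) = ψ (x ⊗ₜ 1) * ρ d := by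
      rw [hρ, ← map_mul, Algebra.TensorProduct.tmul_mul_tmul, mul_one, one_mul]
    rw [h2]
    exact h1
  have hWdense : ∀ x : A, x ∈ W.topologicalClosure := by
    have hrange : Set.range ψ ⊆ W.topologicalClosure := by
      rintro _ ⟨z, rfl⟩
      induction z using TensorProduct.induction_on with
      | zero => rw [map_zero]; exact zero_mem _
      | tmul x d => exact hpure x d
      | add y z hy hz => rw [map_add]; exact add_mem hy hz
    intro x
    exact closure_minimal hrange W.isClosed_topologicalClosure (hψ x)
  have happrox : ∀ s, ∃ x k, x ∈ C k ∧ ‖x - a s‖ < ε := by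
    intro s
    obtain ⟨x, hx, hxs⟩ := Metric.mem_closure_iff.mp (hWdense (a s)) ε hε
    obtain ⟨k, hk⟩ := (hWmem x).mp hx
    exact ⟨x, k, hk, by rwa [dist_comm, dist_eq_norm] at hxs⟩
  choose a' k ha' hk using happrox
  obtain ⟨K, hK⟩ := (Set.finite_range k).bddAbove
  obtain ⟨m, e, hm, he, hcomm⟩ := exists_matrixUnits_commute_of_uhf hD hB hn hdense K
  refine ⟨m, fun i j => ρ (e i j), a', hm, he.map ρ, ?_, hk⟩
  intro s i j
  have h1 : a' s ∈ C K := hCmono (hK ⟨s, rfl⟩) (ha' s)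
  refine h1 (ρ (e i j)) ?_
  rintro _ (⟨x, rfl⟩ | ⟨y, hy, rfl⟩)
  · simp only [hρ]
    rw [← map_mul, ← map_mul, Algebra.TensorProduct.tmul_mul_tmul,
      Algebra.TensorProduct.tmul_mul_tmul, mul_one, mul_one, one_mul, one_mul]
  · exact ((hcomm i j y hy).map ρ).symm

/-! ### Assembly -/

/-- In a unital C*-algebra of real rank zero, the invertible self-adjoint elements are dense. -/
theorem exists_isUnit_of_realRank_eq_zero {A : Type u} [CStarAlgebra A] (hA : realRank A = 0)
    (a : A) (ha : IsSelfAdjoint a) (ε : ℝ) (hε : 0 < ε) :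
    ∃ b, IsSelfAdjoint b ∧ ‖b - a‖ < ε ∧ IsUnit b := by
  rw [realRank] at hA
  have hne : {m : ℕ∞ | ∃ n : ℕ, m = n ∧
    ∀ a : Fin (n + 1) → A, (∀ j, IsSelfAdjoint (a j)) → ∀ ε : ℝ, 0 < ε →
      ∃ b : Fin (n + 1) → A, (∀ j, IsSelfAdjoint (b j)) ∧ (∀ j, ‖b j - a j‖ < ε) ∧
        IsUnit (∑ j, b j ^ 2)}.Nonempty := by
    -- The infimum of the empty set is `⊤`, so the value 0 is attained.
    by_contra hemp
    rw [Set.not_nonempty_iff_eq_empty.mp hemp, sInf_empty] at hA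
    exact ENat.top_ne_zero hA
  obtain ⟨n, hn, h⟩ := csInf_mem hne
  rw [hA] at hn
  obtain rfl : n = 0 := by exact_mod_cast hn.symm
  obtain ⟨b, hb, hba, hu⟩ := h (fun _ => a) (fun _ => ha) ε hε
  refine ⟨b 0, hb 0, hba 0, ?_⟩
  simpa using hu

/-- The error `ε` is split in three: moving into the commutant, passing to finite spectrum (for `a
0` only), and the generating perturbation. The generated algebra contains the approximant `x 2` of
`c` exactly. -/
theorem generatorCondition_one {A : Type u} [CStarAlgebra A] (hA : realRank A = 0)
    {D : Type v} [CStarAlgebra D] (hD : IsUHFOfInfiniteType D)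
    (hAD : TensoriallyAbsorbs A D) : GeneratorCondition A 1 := by
  obtain ⟨E, _, ⟨φ, -, hφ⟩, ⟨θ⟩⟩ := hAD
  let ψ : A ⊗[ℂ] D →⋆ₐ[ℂ] A := (θ.symm : E →⋆ₐ[ℂ] A).comp φ
  have hψ : DenseRange ψ := by
    have hc : Continuous (θ.symm : E → A) := (StarAlgEquiv.isometry θ.symm).continuous
    exact θ.symm.surjective.denseRange.comp hφ hc
  intro a ha ε hε c
  obtain ⟨m, e, x, hm, he, hxe, hx⟩ := exists_approx_commute_matrixUnits
    hD.not_finiteDimensional hD.1 ψ hψ ![a 0, a 1, c] (ε := ε / 3) (by positivity)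
  have hxe' : ∀ s i j, Commute (e i j) (star (x s)) := by
    intro s i j
    have := (hxe s j i).star_star
    rwa [he.star_eq] at this
  -- The approximants of `a 0` and `a 1` need not be self-adjoint; their real parts still commute
  -- with `e` and are no further away.
  let re : A → A := fun y => (2⁻¹ : ℝ) • (y + star y)
  have hre : ∀ y, IsSelfAdjoint (re y) := fun y => .smul (.all _) (.add_star_self y)
  have hree : ∀ s i j, Commute (e i j) (re (x s)) := fun s i j =>
    ((hxe s i j).add_right (hxe' s i j)).smul_right _
  have hrea : ∀ {y z : A}, IsSelfAdjoint z → ‖y - z‖ < ε / 3 → ‖re y - z‖ < ε / 3 := by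
    intro y z hz hyz
    have h1 : re y - z = (2⁻¹ : ℝ) • ((y - z) + star (y - z)) := by
      rw [star_sub, hz.star_eq]
      simp only [re]
      module
    rw [h1, norm_smul, Real.norm_of_nonneg (by norm_num)]
    have h2 := norm_add_le (y - z) (star (y - z))
    rw [norm_star] at h2
    linarith
  let o : Fin m := ⟨0, by omega⟩
  let k : Fin m := ⟨1, by omega⟩
  let l : Fin m := ⟨2, by omega⟩
  obtain ⟨h, hh, hhe, hhx, hfin⟩ := he.exists_finite_spectrum_commute o
    (exists_isUnit_of_realRank_eq_zero hA) (hre (x 0)) (hree 0) (ε := ε / 3) (by positivity)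
  obtain ⟨b₀, hb₀, hb₀h, hgen₀⟩ := he.exists_diagonal_perturbation hh hhe hfin
    (ε := ε / 3) (by positivity)
  obtain ⟨b₁, hb₁, hb₁x, hgen₁⟩ := he.exists_offDiagonal_perturbation (o := o) (k := k) (l := l)
    (by simp [o, k]) (by simp [o, l]) (by simp [k, l]) (hre (x 1)) (hree 1) (hxe 2)
    (ε := ε / 3) (by positivity)
  have h0 := hrea (ha 0) (hx 0)
  have h1 := hrea (ha 1) (hx 1)
  have hmem : ∀ j, (![b₀, b₁] : Fin 2 → A) j ∈ generatedCStar ![b₀, b₁] := fun j =>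
    NonUnitalStarSubalgebra.le_topologicalClosure _
      (NonUnitalStarAlgebra.subset_adjoin ℂ _ ⟨j, rfl⟩)
  refine ⟨![b₀, b₁], ?_, ?_, x 2, ?_, ?_⟩
  · intro j
    fin_cases j
    · exact hb₀
    · exact hb₁
  · intro j
    fin_cases j
    · calc ‖b₀ - a 0‖ = ‖(b₀ - h) + (h - re (x 0)) + (re (x 0) - a 0)‖ := by congr 1; abel
        _ ≤ ‖b₀ - h‖ + ‖h - re (x 0)‖ + ‖re (x 0) - a 0‖ := norm_add₃_le
        _ < ε := by linarith
    · calc ‖b₁ - a 1‖ = ‖(b₁ - re (x 1)) + (re (x 1) - a 1)‖ := by rw [sub_add_sub_cancel]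
        _ ≤ ‖b₁ - re (x 1)‖ + ‖re (x 1) - a 1‖ := norm_add_le _ _
        _ < ε := by linarith
  · exact hgen₁ _ (hmem 1) (hgen₀ _ (hmem 0))
  · have := hx 2
    rw [norm_sub_rev]
    simp only [Matrix.cons_val] at this
    linarith

end CStarGen

theorem mainTheorem6 {A : Type u} [CStarAlgebra A] [TopologicalSpace.SeparableSpace A]
    (hA : CStarGen.realRank A = 0)
    {D : Type v} [CStarAlgebra D] (hD : CStarGen.IsUHFOfInfiniteType D)
    (hAD : CStarGen.TensoriallyAbsorbs A D) :
    CStarGen.generatorRank A ≤ 1 := by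
  rw [CStarGen.generatorRank, if_pos ⟨1, fun a => ⟨one_mul a, mul_one a⟩⟩]
  exact sInf_le ⟨1, by simp, CStarGen.generatorCondition_one hA hD hAD⟩
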